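/- A function $\varphi:[0,\infty)\to\mathbb R$ is called absolutely monotonic if it is infinitely often differentiable on $[0,\infty)$ (with one-sided derivatives at $0$) and $\varphi^{(k)}(t)\ge 0$ for all $k\ge 0$ and $t\ge 0$. A function $g:(0,\infty)\to\mathbb R$ is called completely monotonic if it is infinitely often differentiable and $(-1)^n g^{(n)}(x)\ge 0$ for all $n\ge 0$ and $x>0$. Let $\lambda>0$ be given. The following properties of a function $f:(0,\infty)\to\mathbb R$ are equivalent. (i) There is an absolutely monotonic function $\varphi:[0,\infty)\to\mathbb R$ such that for every $x>0$ the integral below converges and $$f(x)=\int_0^\infty e^{-xt}t^{\lambda-1}\varphi(t)\,dt .$$ (ii) For every integer $k\ge 0$ the function $x\mapsto x^{k+\lambda-1}f(x)$ is $k$ times differentiable on $(0,\infty)$, and $(-1)^k\bigl(x^{k+\lambda-1}f(x)\bigr)^{(k)}$ is completely monotonic. (iii) For every integer $k\ge 0$ the function $x\mapsto x^{k+\lambda-1}f(x)$ is $k$ times differentiable on $(0,\infty)$, and $(-1)^k\bigl(x^{k+\lambda-1}f(x)\bigr)^{(k)}\ge 0$ for all $x>0$. -/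

import Mathlib

open Set
open scoped ContDiff

/-- `f` is completely monotonic on `(0, ∞)`: it is infinitely often differentiable there and
`(-1)^n f^{(n)}(x) ≥ 0` for all `n ≥ 0` and all `x > 0`.
Only the values of `f` on `(0, ∞)` matter. -/
def CompletelyMonotonic (f : ℝ → ℝ) : Prop :=
  ContDiffOn ℝ ∞ f (Ioi 0) ∧
    ∀ n : ℕ, ∀ x : ℝ, 0 < x → 0 ≤ (-1) ^ n * iteratedDerivWithin n f (Ioi 0) x

/-- `g` is `k` times differentiable on `(0, ∞)`: the derivatives `g', …, g^{(k)}` exist there. -/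
def TimesDifferentiable (k : ℕ) (g : ℝ → ℝ) : Prop :=
  ∀ j : ℕ, j < k → DifferentiableOn ℝ (iteratedDerivWithin j g (Ioi 0)) (Ioi 0)

/-- The function `x ↦ x^{k+l-1} f(x)`. -/
noncomputable def powMul (l : ℝ) (k : ℕ) (f : ℝ → ℝ) (x : ℝ) : ℝ :=
  x ^ ((k : ℝ) + l - 1) * f x

/-- The function `x ↦ (-1)^k (x^{k+l-1} f(x))^{(k)}` on `(0, ∞)`. -/
noncomputable def signedDeriv (l : ℝ) (k : ℕ) (f : ℝ → ℝ) (x : ℝ) : ℝ :=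
  (-1) ^ k * iteratedDerivWithin k (powMul l k f) (Ioi 0) x

/-! Inversion turns everything into power series. Write `f x = x ^ (-l) * h x⁻¹`. Then `x^{k+l-1}
f(x) = x^{k-1} h(1/x)`, whose `k`-th derivative is `(-1)^k x^{-k-1} h^{(k)}(1/x)`
(`signedDeriv_eq`). So (iii) says exactly that all derivatives of `h` are nonnegative on `(0, ∞)`,
and by Bernstein's theorem (`exists_isNonnegPowerSeries_eqOn`) `h` is an everywhere convergent
series `∑ d_n u^n` with `d_n ≥ 0`.

On the Laplace side, `c t^n` contributes `c Γ(n+l) x^{-n-l}`; since all terms are nonnegative, sum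
and integral may be exchanged (`laplace_integrableOn_iff`, `laplace_hasSum`). Thus (i) is the same
representation with `d_n = c_n Γ(n+l)`. Finally, (ii) follows because the signed derivative is
`G(1/x)` with `G(u) = u^{k+1} h^{(k)}(u)` again a nonnegative power series, and such a `G(1/x)` is
completely monotonic. -/

/-- `F` is the sum of an everywhere convergent power series with nonnegative coefficients. -/
def IsNonnegPowerSeries (F : ℝ → ℝ) : Prop :=
  ∃ c : ℕ → ℝ, (∀ n, 0 ≤ c n) ∧ ∀ u, HasSum (fun n => c n * u ^ n) (F u)

/-! ### Entire power series with nonnegative coefficients -/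

namespace IsNonnegPowerSeries

theorem of_summable {c : ℕ → ℝ} (hc : ∀ n, 0 ≤ c n)
    (hs : ∀ u : ℝ, 0 < u → Summable fun n => c n * u ^ n) :
    IsNonnegPowerSeries fun u => ∑' n, c n * u ^ n := by
  refine ⟨c, hc, fun u => Summable.hasSum ?_⟩
  -- The `+ 1` keeps the comparison point positive when `u = 0`.
  refine Summable.of_norm_bounded (hs (|u| + 1) (by positivity)) fun n => ?_
  rw [norm_mul, norm_pow, Real.norm_of_nonneg (hc n), Real.norm_eq_abs]
  gcongr
  · exact hc n
  · linarith

theorem nonneg {F : ℝ → ℝ} (hF : IsNonnegPowerSeries F) {u : ℝ} (hu : 0 ≤ u) : 0 ≤ F u := by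
  obtain ⟨c, hc, h⟩ := hF
  exact (h u).nonneg fun n => mul_nonneg (hc n) (pow_nonneg hu n)

theorem id_mul {F : ℝ → ℝ} (hF : IsNonnegPowerSeries F) :
    IsNonnegPowerSeries fun u => u * F u := by
  obtain ⟨c, hc, h⟩ := hF
  refine ⟨fun n => Nat.casesOn n 0 c, fun n => ?_, fun u => ?_⟩
  · cases n with
    | zero => exact le_rfl
    | succ n => exact hc n
  · rw [← hasSum_nat_add_iff' 1]
    simpa [pow_succ', mul_left_comm] using (h u).mul_left u

theorem pow_mul {F : ℝ → ℝ} (hF : IsNonnegPowerSeries F) (m : ℕ) :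
    IsNonnegPowerSeries fun u => u ^ m * F u := by
  induction m with
  | zero => simpa using hF
  | succ m ih => simpa only [pow_succ', mul_assoc] using ih.id_mul

theorem exists_hasDerivAt {F : ℝ → ℝ} (hF : IsNonnegPowerSeries F) :
    ∃ G, IsNonnegPowerSeries G ∧ ∀ u, HasDerivAt F (G u) u := by
  obtain ⟨c, hc, h⟩ := hF
  have hs : ∀ u : ℝ, 0 < u → Summable fun n : ℕ => ((n + 1) * c (n + 1)) * u ^ n := by
    intro u hu
    -- The factor `n + 1` is absorbed by `2 ^ (n + 1)`, so the original series at `2 * (u + 1)`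
    -- dominates.
    have h1 := ((summable_nat_add_iff 1).2 (h (2 * (u + 1))).summable)
    refine Summable.of_nonneg_of_le (fun n => ?_) (fun n => ?_) h1
    · have := hc (n + 1)
      positivity
    · have h2 : ((n : ℝ) + 1) ≤ 2 ^ (n + 1) := by
        exact_mod_cast (Nat.lt_two_pow_self (n := n + 1)).le
      have h3 : u ^ n ≤ (u + 1) ^ (n + 1) := by
        calc u ^ n ≤ (u + 1) ^ n := by gcongr; linarith
          _ ≤ (u + 1) ^ (n + 1) := pow_le_pow_right₀ (by linarith) n.le_succ
      calc ((n : ℝ) + 1) * c (n + 1) * u ^ n = c (n + 1) * (((n : ℝ) + 1) * u ^ n) := by ring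
        _ ≤ c (n + 1) * (2 ^ (n + 1) * (u + 1) ^ (n + 1)) := by
            gcongr
            exact hc _
        _ = _ := by rw [mul_pow]
  have hG := of_summable (fun n => mul_nonneg (by positivity) (hc (n + 1))) hs
  refine ⟨_, hG, fun u => ?_⟩
  have hFe : F = fun u => ∑' n, c n * u ^ n := funext fun u => (h u).tsum_eq.symm
  set R := |u| + 1 with hR
  have hR0 : 0 < R := by positivity
  have hu' : u ∈ Metric.ball (0 : ℝ) R := by simp [hR]
  have hsum : Summable fun n : ℕ => c n * (n * R ^ (n - 1)) := by
    rw [← summable_nat_add_iff 1]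
    refine (hs R hR0).congr fun n => ?_
    push_cast [Nat.add_sub_cancel]
    ring
  have key := hasDerivAt_tsum_of_isPreconnected (g := fun n u => c n * u ^ n)
    (g' := fun n u => c n * (n * u ^ (n - 1))) (y₀ := u) (y := u) hsum Metric.isOpen_ball
    (convex_ball (0 : ℝ) R).isPreconnected
    (fun n y _ => (hasDerivAt_pow n y).const_mul (c n))
    (fun n y hy => by
      rw [norm_mul, norm_mul, norm_pow, Real.norm_of_nonneg (hc n), Real.norm_natCast]
      have : ‖y‖ ≤ R := by simpa using (mem_ball_zero_iff.1 hy).le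
      gcongr
      exact hc n) hu' (h u).summable hu'
  have hs' : Summable fun n : ℕ => c n * (n * u ^ (n - 1)) := by
    refine Summable.of_norm_bounded hsum fun n => ?_
    rw [norm_mul, norm_mul, norm_pow, Real.norm_of_nonneg (hc n), Real.norm_natCast]
    have : ‖u‖ ≤ R := by simp [hR]
    gcongr
    exact hc n
  rw [hFe]
  refine key.congr_deriv ?_
  rw [hs'.tsum_eq_zero_add]
  simp only [Nat.cast_zero, zero_mul, mul_zero, zero_add, Nat.add_sub_cancel]
  refine tsum_congr fun n => ?_
  push_cast
  ring

theorem deriv {F : ℝ → ℝ} (hF : IsNonnegPowerSeries F) : IsNonnegPowerSeries (deriv F) := by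
  obtain ⟨G, hG, h⟩ := hF.exists_hasDerivAt
  rwa [show _root_.deriv F = G from funext fun u => (h u).deriv]

theorem differentiable {F : ℝ → ℝ} (hF : IsNonnegPowerSeries F) : Differentiable ℝ F := by
  obtain ⟨G, -, h⟩ := hF.exists_hasDerivAt
  exact fun u => (h u).differentiableAt

theorem iteratedDeriv {F : ℝ → ℝ} (hF : IsNonnegPowerSeries F) (n : ℕ) :
    IsNonnegPowerSeries (iteratedDeriv n F) := by
  induction n with
  | zero => simpa using hF
  | succ n ih => simpa only [iteratedDeriv_succ] using ih.deriv

theorem contDiff {F : ℝ → ℝ} (hF : IsNonnegPowerSeries F) : ContDiff ℝ ∞ F :=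
  contDiff_of_differentiable_iteratedDeriv fun n _ => (hF.iteratedDeriv n).differentiable

theorem absolutelyMonotoneOn {F : ℝ → ℝ} (hF : IsNonnegPowerSeries F) :
    AbsolutelyMonotoneOn F (Ici 0) :=
  .of_contDiff hF.contDiff fun n _ hx => (hF.iteratedDeriv n).nonneg hx

end IsNonnegPowerSeries

/-! ### Taylor expansion and Bernstein's theorem -/

/-- The Taylor polynomial at `a`, of degree less than `n`, of a function whose successive
derivatives are `D 0, D 1, …`. -/
noncomputable def towerTaylor (D : ℕ → ℝ → ℝ) (a : ℝ) (n : ℕ) (x : ℝ) : ℝ :=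
  ∑ k ∈ Finset.range n, D k a * ((x - a) ^ k / k.factorial)

theorem hasDerivAt_sub_pow_div_factorial (a x : ℝ) (n : ℕ) :
    HasDerivAt (fun x : ℝ => (x - a) ^ (n + 1) / (n + 1).factorial)
      ((x - a) ^ n / n.factorial) x := by
  have := (((hasDerivAt_id x).sub_const a).pow (n + 1)).div_const ((n + 1).factorial : ℝ)
  refine this.congr_deriv ?_
  have : (n.factorial : ℝ) ≠ 0 := by positivity
  push_cast [Nat.factorial_succ, id, Nat.add_sub_cancel]
  field_simp

theorem hasDerivAt_towerTaylor (D : ℕ → ℝ → ℝ) (a : ℝ) (n : ℕ) (x : ℝ) :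
    HasDerivAt (towerTaylor D a (n + 1)) (towerTaylor (fun k => D (k + 1)) a n x) x := by
  have : towerTaylor D a (n + 1) = fun x => (∑ k ∈ Finset.range n,
      D (k + 1) a * ((x - a) ^ (k + 1) / (k + 1).factorial)) + D 0 a := by
    ext x
    simp [towerTaylor, Finset.sum_range_succ']
  rw [this]
  exact (HasDerivAt.fun_sum fun k _ =>
    (hasDerivAt_sub_pow_div_factorial a x k).const_mul _).add_const _

theorem towerTaylor_self (D : ℕ → ℝ → ℝ) (a : ℝ) (n : ℕ) :
    towerTaylor D a (n + 1) a = D 0 a := by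
  simp [towerTaylor, Finset.sum_range_succ']

/-- The remainder vanishes at `a`, and its derivative is the remainder of order `n` for the shifted
tower; so both bounds follow by induction from comparing derivatives. -/
theorem sub_towerTaylor_mem_Icc {a b M : ℝ} (n : ℕ) :
    ∀ {D : ℕ → ℝ → ℝ}, (∀ k, ∀ x ∈ Icc a b, HasDerivAt (D k) (D (k + 1) x) x) →
    (∀ x ∈ Icc a b, D n x ∈ Icc 0 M) → ∀ x ∈ Icc a b,
    D 0 x - towerTaylor D a n x ∈ Icc 0 (M * ((x - a) ^ n / n.factorial)) := by
  induction n with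
  | zero => intro D _ hD x hx; simpa [towerTaylor] using hD x hx
  | succ n ih =>
    intro D hderiv hD x hx
    have hR : ∀ y ∈ Icc a b, HasDerivAt (fun y => D 0 y - towerTaylor D a (n + 1) y)
        (D 1 y - towerTaylor (fun k => D (k + 1)) a n y) y := fun y hy =>
      (hderiv 0 y hy).sub (hasDerivAt_towerTaylor D a n y)
    have hB : ∀ y, HasDerivAt (fun y => M * ((y - a) ^ (n + 1) / (n + 1).factorial))
        (M * ((y - a) ^ n / n.factorial)) y := fun y =>
      (hasDerivAt_sub_pow_div_factorial a y n).const_mul M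
    have hI := ih (D := fun k => D (k + 1)) (fun k => hderiv (k + 1)) hD
    constructor
    · exact image_le_of_deriv_right_le_deriv_boundary (f := fun _ => 0) (f' := fun _ => 0)
        continuousOn_const (fun y _ => hasDerivWithinAt_const ..)
        (by simp [towerTaylor_self]) (HasDerivAt.continuousOn hR)
        (fun y hy => (hR y (Ico_subset_Icc_self hy)).hasDerivWithinAt)
        (fun y hy => (hI y (Ico_subset_Icc_self hy)).1) hx
    · exact image_le_of_deriv_right_le_deriv_boundary (HasDerivAt.continuousOn hR)
        (fun y hy => (hR y (Ico_subset_Icc_self hy)).hasDerivWithinAt)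
        (by simp [towerTaylor_self]) (HasDerivAt.continuousOn fun y _ => hB y)
        (fun y _ => (hB y).hasDerivWithinAt)
        (fun y hy => (hI y (Ico_subset_Icc_self hy)).2) hx

section Bernstein

open Filter Topology

variable {D : ℕ → ℝ → ℝ}

theorem monotoneOn_tower (hderiv : ∀ k, ∀ x, 0 < x → HasDerivAt (D k) (D (k + 1) x) x)
    (hnn : ∀ k, ∀ x, 0 < x → 0 ≤ D k x) (k : ℕ) : MonotoneOn (D k) (Ioi 0) := by
  refine monotoneOn_of_hasDerivWithinAt_nonneg (f' := D (k + 1)) (convex_Ioi 0)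
    (HasDerivAt.continuousOn fun x hx => hderiv k x hx) ?_ ?_
  · rw [interior_Ioi]
    exact fun x hx => (hderiv k x hx).hasDerivWithinAt
  · rw [interior_Ioi]
    exact fun x hx => hnn (k + 1) x hx

/-- By monotonicity of `D n`, the remainder at `x` is at most `D n x * (x - a)^n / n!`. A single
term of the expansion at `x`, evaluated at a point `b` twice as far away, gives `D n x * (2 * (x -
a))^n / n! ≤ D 0 b`, so the remainder is `O(2^{-n})`. -/
theorem hasSum_taylor_tower (hderiv : ∀ k, ∀ x, 0 < x → HasDerivAt (D k) (D (k + 1) x) x)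
    (hnn : ∀ k, ∀ x, 0 < x → 0 ≤ D k x) {a x : ℝ} (ha : 0 < a) (hx : a < x) :
    HasSum (fun k => D k a * ((x - a) ^ k / k.factorial)) (D 0 x) := by
  have hmono := monotoneOn_tower hderiv hnn
  have hx0 : 0 < x := ha.trans hx
  rw [hasSum_iff_tendsto_nat_of_nonneg (fun k => by
    have := hnn k a ha
    have : 0 ≤ x - a := by linarith
    positivity)]
  have hxa : 0 < x - a := by linarith
  have bound : ∀ {a b : ℝ}, 0 < a → a ≤ b → ∀ n,
      D 0 b - towerTaylor D a n b ∈ Icc 0 (D n b * ((b - a) ^ n / n.factorial)) := by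
    intro a b ha hab n
    exact sub_towerTaylor_mem_Icc n (fun k y hy => hderiv k y (ha.trans_le hy.1))
      (fun y hy => ⟨hnn n y (ha.trans_le hy.1),
        hmono n (ha.trans_le hy.1) (ha.trans_le hab) hy.2⟩) b ⟨hab, le_rfl⟩
  set b := x + 2 * (x - a) with hb
  have hDn : ∀ n, D n x * ((2 * (x - a)) ^ n / n.factorial) ≤ D 0 b := by
    intro n
    have h1 := (bound (b := b) hx0 (by linarith) (n + 1)).1
    have h2 : D n x * ((b - x) ^ n / n.factorial) ≤ towerTaylor D x (n + 1) b := by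
      refine Finset.single_le_sum (f := fun k => D k x * ((b - x) ^ k / k.factorial))
        (fun k _ => ?_) (Finset.self_mem_range_succ n)
      have := hnn k x hx0
      have : 0 ≤ b - x := by linarith
      positivity
    rw [show b - x = 2 * (x - a) by rw [hb]; ring] at h2
    linarith
  have hrem : ∀ n, D 0 x - towerTaylor D a n x ≤ D 0 b * (1 / 2) ^ n := by
    intro n
    refine (bound ha hx.le n).2.trans ?_
    calc D n x * ((x - a) ^ n / n.factorial)
        = D n x * ((2 * (x - a)) ^ n / n.factorial) * (1 / 2) ^ n := by
          rw [mul_pow, one_div, inv_pow]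
          field_simp
      _ ≤ _ := by gcongr; exact hDn n
  have hlim : Tendsto (fun n : ℕ => D 0 b * (1 / 2 : ℝ) ^ n) atTop (𝓝 0) := by
    simpa using (tendsto_pow_atTop_nhds_zero_of_lt_one (by norm_num : (0 : ℝ) ≤ 1 / 2)
      (by norm_num)).const_mul (D 0 b)
  have h0 := squeeze_zero (fun n => (bound ha hx.le n).1) hrem hlim
  simpa [towerTaylor] using h0.const_sub (D 0 x)

/-- The centre `a` of the expansion is sent to `0⁺`. Each `D k a` decreases to a limit `L k ≥ 0`,
and dominated convergence applies: the bound `D k u * u^k / k!` is the Taylor series at `u`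
evaluated at `2u`. -/
theorem exists_hasSum_of_tower (hderiv : ∀ k, ∀ x, 0 < x → HasDerivAt (D k) (D (k + 1) x) x)
    (hnn : ∀ k, ∀ x, 0 < x → 0 ≤ D k x) :
    ∃ c : ℕ → ℝ, (∀ n, 0 ≤ c n) ∧ ∀ u, 0 < u → HasSum (fun n => c n * u ^ n) (D 0 u) := by
  have hmono := monotoneOn_tower hderiv hnn
  have hbdd : ∀ k, BddBelow (D k '' Ioi 0) := fun k =>
    ⟨0, by rintro _ ⟨x, hx, rfl⟩; exact hnn k x hx⟩
  set L : ℕ → ℝ := fun k => sInf (D k '' Ioi 0) with hL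
  have hlim : ∀ k, Tendsto (D k) (𝓝[>] 0) (𝓝 (L k)) := fun k =>
    (hmono k).tendsto_nhdsGT (hbdd k)
  have hLle : ∀ k x, 0 < x → L k ≤ D k x := fun k x hx => csInf_le (hbdd k) ⟨x, hx, rfl⟩
  have hL0 : ∀ k, 0 ≤ L k := fun k =>
    le_csInf ⟨_, mem_image_of_mem _ (mem_Ioi.2 one_pos)⟩ (by
      rintro _ ⟨x, hx, rfl⟩; exact hnn k x hx)
  refine ⟨fun n => L n / n.factorial, fun n => div_nonneg (hL0 n) (by positivity),
    fun u hu => ?_⟩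
  have hsum : Summable fun k : ℕ => D k u * (u ^ k / k.factorial) := by
    have := (hasSum_taylor_tower hderiv hnn hu (show u < u + u by linarith)).summable
    simpa using this
  have hev : ∀ᶠ a in 𝓝[>] (0 : ℝ), a ∈ Ioo 0 u := Ioo_mem_nhdsGT hu
  have key : Tendsto (fun a => ∑' k : ℕ, D k a * ((u - a) ^ k / k.factorial)) (𝓝[>] 0)
      (𝓝 (∑' k : ℕ, L k * (u ^ k / k.factorial))) := by
    refine tendsto_tsum_of_dominated_convergence hsum (fun k => ?_) ?_
    · refine (hlim k).mul (Tendsto.div_const ?_ _)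
      have : Tendsto (fun a : ℝ => (u - a) ^ k) (𝓝 0) (𝓝 ((u - 0) ^ k)) :=
        (by fun_prop : Continuous fun a : ℝ => (u - a) ^ k).tendsto 0
      rw [sub_zero] at this
      exact this.mono_left nhdsWithin_le_nhds
    · filter_upwards [hev] with a ha k
      have h1 := hnn k a ha.1
      have h2 : 0 ≤ u - a := by linarith [ha.2]
      rw [Real.norm_of_nonneg (by positivity)]
      have h3 := hmono k ha.1 hu ha.2.le
      have h4 : u - a ≤ u := by linarith [ha.1]
      have h5 := h1.trans h3
      gcongr
  have hconst : (fun a => ∑' k : ℕ, D k a * ((u - a) ^ k / k.factorial)) =ᶠ[𝓝[>] 0]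
      fun _ => D 0 u := by
    filter_upwards [hev] with a ha
    exact (hasSum_taylor_tower hderiv hnn ha.1 ha.2).tsum_eq
  have heq := tendsto_nhds_unique (key.congr' hconst) tendsto_const_nhds
  rw [← heq]
  have hs : Summable fun k : ℕ => L k * (u ^ k / k.factorial) := by
    refine Summable.of_nonneg_of_le (fun k => ?_) (fun k => ?_) hsum
    · have := hL0 k
      positivity
    · gcongr
      exact hLle k u hu
  convert hs.hasSum using 2
  ring

/-- Bernstein's theorem on absolutely monotonic functions: a smooth function on `(0, ∞)` with
nonnegative derivatives is the sum of a power series with nonnegative coefficients. -/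
theorem exists_isNonnegPowerSeries_eqOn {h : ℝ → ℝ} (hh : ContDiffOn ℝ ∞ h (Ioi 0))
    (hnn : ∀ n : ℕ, ∀ x, 0 < x → 0 ≤ iteratedDerivWithin n h (Ioi 0) x) :
    ∃ F, IsNonnegPowerSeries F ∧ EqOn h F (Ioi 0) := by
  obtain ⟨c, hc, hs⟩ := exists_hasSum_of_tower (D := fun n => iteratedDerivWithin n h (Ioi 0))
    (fun k x hx => by
      have h1 := hh.differentiableOn_iteratedDerivWithin (m := k)
        (by exact_mod_cast WithTop.coe_lt_top _) (uniqueDiffOn_Ioi 0)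
      rw [iteratedDerivWithin_succ]
      exact ((h1 x hx).hasDerivWithinAt).hasDerivAt (Ioi_mem_nhds hx)) hnn
  refine ⟨_, .of_summable hc fun u hu => (hs u hu).summable, fun u hu => ?_⟩
  simpa using (hs u hu).tsum_eq.symm

end Bernstein

/-! ### Derivatives on the half-line and the inversion `x ↦ 1/x` -/

theorem TimesDifferentiable.of_contDiffOn {g : ℝ → ℝ} (hg : ContDiffOn ℝ ∞ g (Ioi 0)) (k : ℕ) :
    TimesDifferentiable k g := fun j _ =>
  hg.differentiableOn_iteratedDerivWithin (by exact_mod_cast WithTop.coe_lt_top _)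
    (uniqueDiffOn_Ioi 0)

theorem TimesDifferentiable.contDiffOn {g : ℝ → ℝ} {n : ℕ} (hg : TimesDifferentiable (n + 1) g) :
    ContDiffOn ℝ n g (Ioi 0) := by
  have := contDiffOn_of_differentiableOn_deriv (n := (n : ℕ∞)) fun m hm =>
    hg m (Nat.lt_succ_of_le (by exact_mod_cast hm))
  exact_mod_cast this

theorem iteratedDerivWithin_succ_of_hasDerivAt {f g : ℝ → ℝ} {n : ℕ}
    (h : ∀ x, 0 < x → iteratedDerivWithin n f (Ioi 0) x = g x) {x g' : ℝ} (hx : 0 < x)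
    (hg : HasDerivAt g g' x) : iteratedDerivWithin (n + 1) f (Ioi 0) x = g' := by
  rw [iteratedDerivWithin_succ, derivWithin_congr (f := g) (s := Ioi 0) (fun x hx => h x hx) (h x hx)]
  exact hg.hasDerivWithinAt.derivWithin (uniqueDiffOn_Ioi 0 x hx)

theorem ContDiffOn.hasDerivAt_iteratedDerivWithin_Ioi {h : ℝ → ℝ}
    (hh : ContDiffOn ℝ ∞ h (Ioi 0)) (k : ℕ) {x : ℝ} (hx : 0 < x) :
    HasDerivAt (iteratedDerivWithin k h (Ioi 0)) (iteratedDerivWithin (k + 1) h (Ioi 0) x) x := by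
  rw [iteratedDerivWithin_succ]
  exact ((TimesDifferentiable.of_contDiffOn hh (k + 1) k k.lt_succ_self x
    hx).hasDerivWithinAt).hasDerivAt (Ioi_mem_nhds hx)

theorem iteratedDerivWithin_id_mul {y : ℝ → ℝ} (hy : ContDiffOn ℝ ∞ y (Ioi 0)) (k : ℕ) :
    ∀ x, 0 < x → iteratedDerivWithin (k + 1) (fun x => x * y x) (Ioi 0) x =
      x * iteratedDerivWithin (k + 1) y (Ioi 0) x +
        (k + 1) * iteratedDerivWithin k y (Ioi 0) x := by
  have hd := fun k {x : ℝ} => hy.hasDerivAt_iteratedDerivWithin_Ioi k (x := x)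
  induction k with
  | zero =>
    intro x hx
    have h0 : ∀ x, 0 < x → iteratedDerivWithin 0 (fun x => x * y x) (Ioi 0) x =
        x * iteratedDerivWithin 0 y (Ioi 0) x := fun x _ => by simp
    refine (iteratedDerivWithin_succ_of_hasDerivAt h0 hx
      ((hasDerivAt_id x).mul (hd 0 hx))).trans ?_
    push_cast [id]
    ring
  | succ k ih =>
    intro x hx
    refine (iteratedDerivWithin_succ_of_hasDerivAt ih hx
      (((hasDerivAt_id x).mul (hd (k + 1) hx)).add
        ((hd k hx).const_mul ((k : ℝ) + 1)))).trans ?_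
    push_cast [id]
    ring

theorem iteratedDerivWithin_congr_of_pos {f g : ℝ → ℝ} (h : ∀ x, 0 < x → f x = g x) (n : ℕ)
    {x : ℝ} (hx : 0 < x) :
    iteratedDerivWithin n f (Ioi 0) x = iteratedDerivWithin n g (Ioi 0) x :=
  iteratedDerivWithin_congr (fun x hx => h x hx) hx

theorem contDiffOn_comp_inv {h : ℝ → ℝ} (hh : ContDiffOn ℝ ∞ h (Ioi 0)) :
    ContDiffOn ℝ ∞ (fun x => h x⁻¹) (Ioi 0) :=
  hh.comp (contDiffOn_id.inv fun _ hx => (mem_Ioi.1 hx).ne') fun _ hx =>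
    mem_Ioi.2 (inv_pos.2 hx)

theorem contDiffOn_pow_mul_inv {h : ℝ → ℝ} (hh : ContDiffOn ℝ ∞ h (Ioi 0)) (k : ℕ) :
    ContDiffOn ℝ ∞ (fun x => x ^ k * (x⁻¹ * h x⁻¹)) (Ioi 0) :=
  (contDiffOn_id.pow k).mul
    ((contDiffOn_id.inv fun _ hx => (mem_Ioi.1 hx).ne').mul (contDiffOn_comp_inv hh))

/-- `(x^{k-1} h(1/x))^{(k)} = (-1)^k x^{-k-1} h^{(k)}(1/x)`. -/
theorem iteratedDerivWithin_pow_mul_comp_inv {h : ℝ → ℝ} (hh : ContDiffOn ℝ ∞ h (Ioi 0)) (k : ℕ) :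
    ∀ x, 0 < x → iteratedDerivWithin k (fun x => x ^ k * (x⁻¹ * h x⁻¹)) (Ioi 0) x =
      (-1) ^ k * (x⁻¹ ^ (k + 1) * iteratedDerivWithin k h (Ioi 0) x⁻¹) := by
  induction k with
  | zero => intro x hx; simp
  | succ k ih =>
    intro x hx
    have hy := contDiffOn_pow_mul_inv hh k
    rw [iteratedDerivWithin_congr_of_pos (g := fun x => x * (x ^ k * (x⁻¹ * h x⁻¹)))
      (fun x _ => by ring) _ hx, iteratedDerivWithin_id_mul hy k x hx, ih x hx,
      iteratedDerivWithin_succ_of_hasDerivAt ih hx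
        (((((hasDerivAt_inv hx.ne').pow (k + 1)).mul
          ((hh.hasDerivAt_iteratedDerivWithin_Ioi k (inv_pos.2 hx)).comp x
            (hasDerivAt_inv hx.ne')))).const_mul ((-1 : ℝ) ^ k))]
    -- The `h^{(k)}` terms cancel: `x` times the derivative of `x^{-k-1}` is `-(k+1) x^{-k-1}`,
    -- opposite to the second Leibniz term.
    have hxx : x * x⁻¹ = 1 := mul_inv_cancel₀ hx.ne'
    simp only [Nat.add_sub_cancel, Function.comp, Pi.pow_apply]
    push_cast
    linear_combination (-((k : ℝ) + 1) * (-1) ^ k * x⁻¹ ^ (k + 1) *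
      iteratedDerivWithin k h (Ioi 0) x⁻¹ - (-1) ^ k * x⁻¹ ^ (k + 2) *
      iteratedDerivWithin (k + 1) h (Ioi 0) x⁻¹) * hxx

theorem powMul_eq {l x : ℝ} (hx : 0 < x) (k : ℕ) {f h : ℝ → ℝ} (hf : f x = x ^ (-l) * h x⁻¹) :
    powMul l k f x = x ^ k * (x⁻¹ * h x⁻¹) := by
  rw [powMul, hf, ← mul_assoc, ← Real.rpow_add hx,
    show (k : ℝ) + l - 1 + -l = k + -1 by ring, Real.rpow_add hx, Real.rpow_natCast,
    Real.rpow_neg_one, mul_assoc]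

theorem signedDeriv_eq {l : ℝ} {f h : ℝ → ℝ} (hh : ContDiffOn ℝ ∞ h (Ioi 0))
    (hf : ∀ x, 0 < x → f x = x ^ (-l) * h x⁻¹) (k : ℕ) {x : ℝ} (hx : 0 < x) :
    signedDeriv l k f x = x⁻¹ ^ (k + 1) * iteratedDerivWithin k h (Ioi 0) x⁻¹ := by
  rw [signedDeriv, iteratedDerivWithin_congr_of_pos (fun x hx => powMul_eq hx k (hf x hx)) k hx,
    iteratedDerivWithin_pow_mul_comp_inv hh k x hx, ← mul_assoc, ← mul_pow]
  simp

theorem timesDifferentiable_powMul {l : ℝ} {f h : ℝ → ℝ} (hh : ContDiffOn ℝ ∞ h (Ioi 0))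
    (hf : ∀ x, 0 < x → f x = x ^ (-l) * h x⁻¹) (k : ℕ) :
    TimesDifferentiable k (powMul l k f) :=
  .of_contDiffOn ((contDiffOn_pow_mul_inv hh k).congr fun x hx => powMul_eq hx k (hf x hx)) k

theorem CompletelyMonotonic.congr {f g : ℝ → ℝ} (hg : CompletelyMonotonic g)
    (h : ∀ x, 0 < x → f x = g x) : CompletelyMonotonic f :=
  ⟨hg.1.congr h, fun n x hx => by
    rw [iteratedDerivWithin_congr_of_pos h n hx]; exact hg.2 n x hx⟩

theorem IsNonnegPowerSeries.completelyMonotonic_comp_inv {G : ℝ → ℝ}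
    (hG : IsNonnegPowerSeries G) : CompletelyMonotonic fun x => G x⁻¹ := by
  refine ⟨contDiffOn_comp_inv hG.contDiff.contDiffOn, fun n => ?_⟩
  -- Since `(H(1/x))' = -x^{-2} H'(1/x)`, each derivative flips the sign and replaces `H(u)` by `u^2
  -- H'(u)`, again a nonnegative power series.
  have key : ∃ H, IsNonnegPowerSeries H ∧ ∀ x, 0 < x →
      iteratedDerivWithin n (fun x => G x⁻¹) (Ioi 0) x = (-1) ^ n * H x⁻¹ := by
    induction n with
    | zero => exact ⟨G, hG, fun x _ => by simp⟩
    | succ n ih =>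
      obtain ⟨H, hH, h⟩ := ih
      obtain ⟨H', hH', hd⟩ := hH.exists_hasDerivAt
      refine ⟨_, hH'.pow_mul 2, fun x hx => ?_⟩
      refine (iteratedDerivWithin_succ_of_hasDerivAt h hx
        (((hd x⁻¹).comp x (hasDerivAt_inv hx.ne')).const_mul ((-1 : ℝ) ^ n))).trans ?_
      rw [pow_succ, inv_pow]
      ring
  obtain ⟨H, hH, h⟩ := key
  intro x hx
  rw [h x hx, ← mul_assoc, ← mul_pow]
  simpa using hH.nonneg (inv_pos.2 hx).le

theorem IsNonnegPowerSeries.completelyMonotonic_signedDeriv {l : ℝ} {f F : ℝ → ℝ}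
    (hF : IsNonnegPowerSeries F) (hf : ∀ x, 0 < x → f x = x ^ (-l) * F x⁻¹) (k : ℕ) :
    CompletelyMonotonic (signedDeriv l k f) := by
  refine ((hF.iteratedDeriv k).pow_mul (k + 1)).completelyMonotonic_comp_inv.congr
    fun x hx => ?_
  rw [signedDeriv_eq hF.contDiff.contDiffOn hf k hx,
    iteratedDerivWithin_of_isOpen isOpen_Ioi (inv_pos.2 hx)]

theorem contDiffOn_rpow_Ioi (p : ℝ) : ContDiffOn ℝ ∞ (fun x : ℝ => x ^ p) (Ioi 0) :=
  contDiffOn_id.rpow_const_of_ne fun _ hx => (mem_Ioi.1 hx).ne'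

theorem exists_isNonnegPowerSeries_of_signedDeriv_nonneg {l : ℝ} {f : ℝ → ℝ}
    (hd : ∀ k, TimesDifferentiable k (powMul l k f))
    (hnn : ∀ k, ∀ x, 0 < x → 0 ≤ signedDeriv l k f x) :
    ∃ F, IsNonnegPowerSeries F ∧ ∀ x, 0 < x → f x = x ^ (-l) * F x⁻¹ := by
  have hfs : ContDiffOn ℝ ∞ f (Ioi 0) := by
    -- The hypothesis at `k = n + 1` makes `f` times a power of `x` of class `C^n`; the power is
    -- then divided out.
    refine contDiffOn_infty.2 fun n => ?_
    refine (((contDiffOn_rpow_Ioi (-(((n + 1 : ℕ) : ℝ) + l - 1))).of_le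
      (by exact_mod_cast le_top)).mul (hd (n + 1)).contDiffOn).congr fun x hx => ?_
    rw [powMul, ← mul_assoc, ← Real.rpow_add hx]
    simp
  set h : ℝ → ℝ := fun u => u ^ (-l) * f u⁻¹ with hh
  have hhs : ContDiffOn ℝ ∞ h (Ioi 0) := (contDiffOn_rpow_Ioi _).mul (contDiffOn_comp_inv hfs)
  have hf : ∀ x, 0 < x → f x = x ^ (-l) * h x⁻¹ := fun x hx => by
    rw [hh]
    simp only [inv_inv]
    rw [Real.inv_rpow hx.le, mul_inv_cancel_left₀ (Real.rpow_pos_of_pos hx _).ne']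
  obtain ⟨F, hF, hFe⟩ := exists_isNonnegPowerSeries_eqOn hhs fun n u hu => by
    have := hnn n u⁻¹ (inv_pos.2 hu)
    rw [signedDeriv_eq hhs hf n (inv_pos.2 hu), inv_inv] at this
    exact nonneg_of_mul_nonneg_right this (by positivity)
  exact ⟨F, hF, fun x hx => by rw [hf x hx, hFe (inv_pos.2 hx)]⟩

/-! ### Termwise Laplace transforms -/

section Laplace

open MeasureTheory

theorem laplace_monomial {l x : ℝ} (hl : 0 < l) (hx : 0 < x) (c : ℝ) (n : ℕ) :
    IntegrableOn (fun t : ℝ => Real.exp (-(x * t)) * t ^ (l - 1) * (c * t ^ n)) (Ioi 0) ∧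
      ∫ t in Ioi (0 : ℝ), Real.exp (-(x * t)) * t ^ (l - 1) * (c * t ^ n) =
        x ^ (-l) * (c * Real.Gamma (n + l) * x⁻¹ ^ n) := by
  have hnl : 0 < n + l := by positivity
  have heq : EqOn (fun t : ℝ => Real.exp (-(x * t)) * t ^ (l - 1) * (c * t ^ n))
      (fun t => c * (t ^ (n + l - 1) * Real.exp (-(x * t)))) (Ioi 0) := fun t ht => by
    have : t ^ (n + l - 1) = t ^ n * t ^ (l - 1) := by
      rw [← Real.rpow_natCast, ← Real.rpow_add ht, add_sub_assoc]
    simp only [this]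
    ring
  constructor
  · refine (IntegrableOn.congr_fun ?_ heq.symm measurableSet_Ioi)
    have := integrableOn_rpow_mul_exp_neg_mul_rpow (s := n + l - 1) (by linarith) one_pos hx
    simp only [Real.rpow_one, neg_mul] at this
    exact this.const_mul c
  · rw [setIntegral_congr_fun measurableSet_Ioi heq, integral_const_mul,
      Real.integral_rpow_mul_exp_neg_mul_Ioi hnl hx, one_div, Real.rpow_add (inv_pos.2 hx),
      Real.rpow_natCast, Real.rpow_neg hx.le, Real.inv_rpow hx.le]
    ring

variable {l x : ℝ} {c : ℕ → ℝ} {φ : ℝ → ℝ}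

/-- Tonelli: the integrand is a sum of nonnegative terms, so its integral in `[0, ∞]` is the sum of
the monomial integrals, finite exactly when the series converges. -/
theorem laplace_integrableOn_iff (hl : 0 < l) (hx : 0 < x) (hc : ∀ n, 0 ≤ c n)
    (hφ : ∀ t, 0 < t → HasSum (fun n => c n * t ^ n) (φ t)) :
    IntegrableOn (fun t : ℝ => Real.exp (-(x * t)) * t ^ (l - 1) * φ t) (Ioi 0) ↔
      Summable fun n : ℕ => c n * Real.Gamma (n + l) * x⁻¹ ^ n := by
  have hterm : ∀ n, ∀ t ∈ Ioi (0 : ℝ),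
      0 ≤ Real.exp (-(x * t)) * t ^ (l - 1) * (c n * t ^ n) := fun n t ht => by
    have := hc n
    have : 0 < t := ht
    positivity
  have hsum : ∀ t ∈ Ioi (0 : ℝ), HasSum
      (fun n => Real.exp (-(x * t)) * t ^ (l - 1) * (c n * t ^ n))
      (Real.exp (-(x * t)) * t ^ (l - 1) * φ t) := fun t ht => (hφ t ht).mul_left _
  have hnn : ∀ t ∈ Ioi (0 : ℝ), 0 ≤ Real.exp (-(x * t)) * t ^ (l - 1) * φ t := fun t ht =>
    (hsum t ht).nonneg fun n => hterm n t ht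
  have hmeas : AEStronglyMeasurable (fun t : ℝ => Real.exp (-(x * t)) * t ^ (l - 1) * φ t)
      (volume.restrict (Ioi 0)) := by
    -- `φ` is known only through its series, so measurability comes from the partial sums.
    refine aestronglyMeasurable_of_tendsto_ae Filter.atTop
      (f := fun N t => ∑ n ∈ Finset.range N,
        Real.exp (-(x * t)) * t ^ (l - 1) * (c n * t ^ n)) (fun N => ?_) ?_
    · exact (integrable_finsetSum _ fun n _ =>
        (laplace_monomial hl hx (c n) n).1).aestronglyMeasurable
    · exact ae_restrict_of_forall_mem measurableSet_Ioi fun t ht =>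
        (hsum t ht).tendsto_sum_nat
  have hlint : ∫⁻ t in Ioi (0 : ℝ),
      ENNReal.ofReal (Real.exp (-(x * t)) * t ^ (l - 1) * φ t) =
      ∑' n : ℕ, ENNReal.ofReal (x ^ (-l) * (c n * Real.Gamma (n + l) * x⁻¹ ^ n)) := by
    rw [setLIntegral_congr_fun (g := fun t => ∑' n, ENNReal.ofReal
      (Real.exp (-(x * t)) * t ^ (l - 1) * (c n * t ^ n))) measurableSet_Ioi fun t ht => by
        simp only
        rw [← (hsum t ht).tsum_eq, ENNReal.ofReal_tsum_of_nonneg (fun n => hterm n t ht)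
          (hsum t ht).summable]]
    rw [lintegral_tsum fun n =>
      (laplace_monomial hl hx (c n) n).1.aestronglyMeasurable.aemeasurable.ennreal_ofReal]
    refine tsum_congr fun n => ?_
    rw [← (laplace_monomial hl hx (c n) n).2, ofReal_integral_eq_lintegral_ofReal
      (laplace_monomial hl hx (c n) n).1
      (ae_restrict_of_forall_mem measurableSet_Ioi (hterm n))]
  have hxl : 0 < x ^ (-l) := Real.rpow_pos_of_pos hx _
  rw [← summable_mul_left_iff hxl.ne']
  have hiff : IntegrableOn (fun t : ℝ => Real.exp (-(x * t)) * t ^ (l - 1) * φ t) (Ioi 0) ↔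
      ∑' n : ℕ, ENNReal.ofReal (x ^ (-l) * (c n * Real.Gamma (n + l) * x⁻¹ ^ n)) < ⊤ := by
    rw [IntegrableOn, Integrable, and_iff_right hmeas, hasFiniteIntegral_iff_ofReal
      (ae_restrict_of_forall_mem measurableSet_Ioi hnn), hlint]
  rw [hiff]
  refine ⟨fun h => ?_, fun h => h.tsum_ofReal_lt_top⟩
  refine (ENNReal.summable_toReal h.ne).congr fun n => ENNReal.toReal_ofReal ?_
  have := hc n
  have := Real.Gamma_nonneg_of_nonneg (show 0 ≤ n + l by positivity)
  positivity

theorem laplace_hasSum (hl : 0 < l) (hx : 0 < x) (hc : ∀ n, 0 ≤ c n)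
    (hφ : ∀ t, 0 < t → HasSum (fun n => c n * t ^ n) (φ t))
    (hs : Summable fun n : ℕ => c n * Real.Gamma (n + l) * x⁻¹ ^ n) :
    ∫ t in Ioi (0 : ℝ), Real.exp (-(x * t)) * t ^ (l - 1) * φ t =
      x ^ (-l) * ∑' n : ℕ, c n * Real.Gamma (n + l) * x⁻¹ ^ n := by
  have hnorm : ∀ n, ∫ t in Ioi (0 : ℝ), ‖Real.exp (-(x * t)) * t ^ (l - 1) * (c n * t ^ n)‖ =
      x ^ (-l) * (c n * Real.Gamma (n + l) * x⁻¹ ^ n) := fun n => by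
    rw [← (laplace_monomial hl hx (c n) n).2]
    refine setIntegral_congr_fun measurableSet_Ioi fun t ht => Real.norm_of_nonneg ?_
    have := hc n
    have : 0 < t := ht
    positivity
  have key := hasSum_integral_of_summable_integral_norm
    (fun n => (laplace_monomial hl hx (c n) n).1)
    ((hs.mul_left (x ^ (-l))).congr fun n => (hnorm n).symm)
  rw [← tsum_mul_left, ← tsum_congr fun n => (laplace_monomial hl hx (c n) n).2, key.tsum_eq]
  exact setIntegral_congr_fun measurableSet_Ioi fun t ht =>
    ((hφ t ht).mul_left _).tsum_eq.symm

end Laplace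

/-! ### The equivalence -/

theorem AbsolutelyMonotoneOn.exists_hasSum {φ : ℝ → ℝ} (hφ : AbsolutelyMonotoneOn φ (Ici 0)) :
    ∃ c : ℕ → ℝ, (∀ n, 0 ≤ c n) ∧ ∀ t, 0 < t → HasSum (fun n => c n * t ^ n) (φ t) := by
  obtain ⟨F, ⟨c, hc, hF⟩, heq⟩ := exists_isNonnegPowerSeries_eqOn
    (hφ.contDiffOn.mono Ioi_subset_Ici_self) fun n x hx => by
      have h1 := hφ.iteratedDerivWithin_nonneg (uniqueDiffOn_Ici 0) n (mem_Ici.2 hx.le)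
      have h2 : iteratedDerivWithin n φ (Ioi 0) x = iteratedDerivWithin n φ (Ici 0) x := by
        simp only [iteratedDerivWithin]
        congr 1
        refine iteratedFDerivWithin_congr_set ?_ n
        filter_upwards [Ioi_mem_nhds hx] with y hy
        exact propext ⟨fun _ => le_of_lt (mem_Ioi.1 hy), fun _ => hy⟩
      rwa [h2]
  exact ⟨c, hc, fun t ht => by rw [heq ht]; exact hF t⟩

theorem theorem4 (l : ℝ) (hl : 0 < l) (f : ℝ → ℝ) :
    List.TFAE
      [∃ φ : ℝ → ℝ, AbsolutelyMonotoneOn φ (Set.Ici 0) ∧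
          ∀ x : ℝ, 0 < x →
            MeasureTheory.IntegrableOn
              (fun t : ℝ => Real.exp (-(x * t)) * t ^ (l - 1) * φ t) (Set.Ioi 0) ∧
            f x = ∫ t in Set.Ioi (0 : ℝ), Real.exp (-(x * t)) * t ^ (l - 1) * φ t,
        ∀ k : ℕ, TimesDifferentiable k (powMul l k f) ∧
          CompletelyMonotonic (signedDeriv l k f),
        ∀ k : ℕ, TimesDifferentiable k (powMul l k f) ∧
          ∀ x : ℝ, 0 < x → 0 ≤ signedDeriv l k f x] := by
  have hΓ : ∀ n : ℕ, 0 < Real.Gamma (n + l) := fun n => Real.Gamma_pos_of_pos (by positivity)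
  tfae_have 1 → 2 := by
    rintro ⟨φ, hφ, hf⟩ k
    obtain ⟨c, hc, hs⟩ := hφ.exists_hasSum
    have hsum : ∀ x : ℝ, 0 < x → Summable fun n : ℕ => c n * Real.Gamma (n + l) * x⁻¹ ^ n :=
      fun x hx => (laplace_integrableOn_iff hl hx hc hs).1 (hf x hx).1
    have hF := IsNonnegPowerSeries.of_summable (fun n => mul_nonneg (hc n) (hΓ n).le)
      fun u hu => by simpa using hsum u⁻¹ (inv_pos.2 hu)
    have hfF : ∀ x, 0 < x → f x = _ := fun x hx =>
      (hf x hx).2.trans (laplace_hasSum hl hx hc hs (hsum x hx))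
    exact ⟨timesDifferentiable_powMul hF.contDiff.contDiffOn hfF k,
      hF.completelyMonotonic_signedDeriv hfF k⟩
  tfae_have 2 → 3 := fun h k => ⟨(h k).1, fun x hx => by simpa using (h k).2.2 0 x hx⟩
  tfae_have 3 → 1 := by
    intro h
    obtain ⟨F, ⟨d, hd, hF⟩, hf⟩ := exists_isNonnegPowerSeries_of_signedDeriv_nonneg
      (fun k => (h k).1) fun k => (h k).2
    set c : ℕ → ℝ := fun n => d n / Real.Gamma (n + l) with hcdef
    have hc : ∀ n, 0 ≤ c n := fun n => div_nonneg (hd n) (hΓ n).le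
    have hcd : ∀ n, c n * Real.Gamma (n + l) = d n := fun n => div_mul_cancel₀ _ (hΓ n).ne'
    have hsum : ∀ u : ℝ, Summable fun n : ℕ => c n * Real.Gamma (n + l) * u ^ n := fun u => by
      simpa only [hcd] using (hF u).summable
    have hs : ∀ u : ℝ, 0 < u → Summable fun n => c n * u ^ n := fun u hu => by
      -- Dropping two terms puts the Gamma argument in `[2, ∞)`, where Gamma is increasing and at
      -- least `Γ(2) = 1`; hence `c_n ≤ d_n` there.
      rw [← summable_nat_add_iff 2]
      refine Summable.of_nonneg_of_le (fun n => mul_nonneg (hc _) (pow_nonneg hu.le _))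
        (fun n => ?_) ((summable_nat_add_iff 2).2 (hF u).summable)
      have h1 : 1 ≤ Real.Gamma ((n + 2 : ℕ) + l) := by
        rw [← Real.Gamma_two]
        have h2 : (2 : ℝ) ≤ (n + 2 : ℕ) + l := by
          push_cast
          linarith [n.cast_nonneg (α := ℝ)]
        exact Real.Gamma_strictMonoOn_Ici.monotoneOn (mem_Ici.2 le_rfl) (mem_Ici.2 h2) h2
      gcongr
      exact div_le_self (hd _) h1
    refine ⟨_, (IsNonnegPowerSeries.of_summable hc hs).absolutelyMonotoneOn, fun x hx => ?_⟩
    have hφ := fun t ht => (hs t ht).hasSum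
    refine ⟨(laplace_integrableOn_iff hl hx hc hφ).2 (hsum _), ?_⟩
    rw [laplace_hasSum hl hx hc hφ (hsum _), hf x hx, ← (hF x⁻¹).tsum_eq]
    simp only [hcd]
  tfae_finish
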